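/- For a string $x_1\cdots x_n$ of integers let $\mathrm{asc}(x_1\cdots x_n)$ be the number of $j$ with $x_j<x_{j+1}$. An ascent sequence of length $n$ is a string $x_1\cdots x_n$ of nonnegative integers with $x_1=0$ (if $n\ge 1$) and $x_i\le \mathrm{asc}(x_1\cdots x_{i-1})+1$ for $1<i\le n$; the empty string is the only ascent sequence of length $0$. The reduction of a string is obtained by replacing every occurrence of its $i$th smallest value by $i-1$; a string contains a pattern $p$ if some (not necessarily consecutive) subsequence of it has reduction $p$, and avoids $p$ otherwise. Let $\mathcal A_{100,101}(n)$ be the set of ascent sequences of length $n$ that avoid both $100$ and $101$, and let $a_{100,101}(n)=|\mathcal A_{100,101}(n)|$. Let $\mathcal D(n)$ be the set of Dyck words of semilength $n$ (words with $n$ letters $U$ and $n$ letters $D$, every prefix of which has at least as many $U$s as $D$s) that have no four consecutive letters $DDUU$. Proposition. (i) As formal power series, $$\sum_{n\ge 0} a_{100,101}(n)\,x^n=\frac{(1-x)^2-\sqrt{1-4x+2x^2+x^4}}{2x^2},$$ where the square root is the one with constant term $1$. (ii) For every $n\ge 0$ the set $\mathcal A_{100,101}(n)$ is in bijection with $\mathcal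 D(n)$. More precisely, for $d\in\mathcal D(n)$ let $w(d)=w_1\cdots w_n$, where $w_i$ is the number of $U$s minus the number of $D$s preceding the $i$th $U$ of $d$. Given a word $w=w_1\cdots w_n$ that contains $100$, let $k$ be the smallest index for which there are $i<j<k$ with $w_i>w_j=w_k$, let $\ell$ be the smallest index with $\ell>k$ and $w_\ell<w_k$ (and $\ell=n+1$ if there is none), and define the lift of $w$ as the word obtained from $w$ by adding $\max(w_1,\dots,w_{k-1})+1-w_k$ to each of $w_k,\dots,w_{\ell-1}$. Starting from $w(d)$ and lifting repeatedly, one reaches after finitely many lifts a word $\phi(d)$ in $\mathcal A_{100,101}(n)$, to which no further lift applies, and $\phi:\mathcal D(n)\to\mathcal A_{100,101}(n)$ is a bijection. -/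

import Mathlib

/-- The number of ascents of an integer string: positions `j` with `x_j < x_{j+1}`. -/
def numAscents (x : List ℕ) : ℕ :=
  ((Finset.range (x.length - 1)).filter fun j => x.getD j 0 < x.getD (j + 1) 0).card

/-- Ascent sequences (0-indexed): the first entry is `0`, and every later entry is at most one more
than the number of ascents of the string preceding it. -/
def IsAscentSequence (x : List ℕ) : Prop :=
  (0 < x.length → x.getD 0 0 = 0) ∧
    ∀ i, 0 < i → i < x.length → x.getD i 0 ≤ numAscents (x.take i) + 1

/-- The reduction of a string: each entry is replaced by the number of distinct smaller values
occurring in the string, so that the `i`th smallest value becomes `i - 1`. -/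
def reduction (x : List ℕ) : List ℕ :=
  x.map fun a => (x.toFinset.filter (· < a)).card

/-- `x` contains the pattern `p` if some (not necessarily consecutive) subsequence of `x`
has reduction `p`. -/
def ContainsPattern (x p : List ℕ) : Prop :=
  ∃ y : List ℕ, y.Sublist x ∧ reduction y = p

/-- The set of ascent sequences of length `n` avoiding all patterns in `B`. -/
def ascentAvoiders (B : Set (List ℕ)) (n : ℕ) : Set (List ℕ) :=
  {x | x.length = n ∧ IsAscentSequence x ∧ ∀ p ∈ B, ¬ ContainsPattern x p}

/-- The Dyck words of semilength `n` with no factor (block of consecutive letters) `DDUU`. -/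
def dyckAvoidDDUU (n : ℕ) : Set DyckWord :=
  {d | d.semilength = n ∧
    ¬ [DyckStep.D, DyckStep.D, DyckStep.U, DyckStep.U].IsInfix d.toList}

/-- The starting heights, in order, of the upsteps of a path that starts at height `h`. -/
def upHeightsFrom : ℕ → List DyckStep → List ℕ
  | _, [] => []
  | h, DyckStep.U :: s => h :: upHeightsFrom (h + 1) s
  | h, DyckStep.D :: s => upHeightsFrom (h - 1) s

/-- The up-step height word of a Dyck word. -/
def upHeightWord (d : DyckWord) : List ℕ :=
  upHeightsFrom 0 d.toList

/-- A copy `w_i w_j w_k` (with `i < j < k`) of the pattern `100` ends at index `k` of `w`. -/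
def Copy100EndsAt (w : List ℕ) (k : ℕ) : Prop :=
  ∃ i j, i < j ∧ j < k ∧ k < w.length ∧
    w.getD j 0 = w.getD k 0 ∧ w.getD j 0 < w.getD i 0

/-- `w'` is obtained from `w` by a lift: let `k` be the smallest index at which a copy of `100`
ends. The lifted part is the longest block `w_k w_{k+1} ⋯ w_{l-1}` of entries `≥ w_k`,
and `max (w_0, …, w_{k-1}) + 1 - w_k` is added to each of its entries. (Here the maximum exceeds
`w_k`, so that the subtraction is not truncated.) -/
def IsLift (w w' : List ℕ) : Prop :=
  ∃ k, IsLeast {k | Copy100EndsAt w k} k ∧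
    w' = w.take k
      ++ ((w.drop k).takeWhile (fun b => w.getD k 0 ≤ b)).map
          (· + ((w.take k).foldr max 0 + 1 - w.getD k 0))
      ++ (w.drop k).dropWhile (fun b => w.getD k 0 ≤ b)

/-! Height words of Dyck paths and avoiding ascent sequences are both built letter by letter, and
the choices available match. For height words, avoiding `DDUU` means that a descent is never
followed by an ascent, so the current height `h` and one flag determine the possible continuations
(`heightOK_iff`). For ascent sequences, avoidance makes every ascent an ascent to a new value; the
ascent bound then says that a letter is either the next unused value or an old value that is still
reusable (`avoidingAscent_iff_restricted`).

The reusable values form a stack `F 0 < F 1 < ...`, reaching level `h`, or only level `h - 1` if the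
flag is set. Reading a height where the stack has a value repeats that value and drops those above
it; after a descent the repeated value is spent too. The only other admissible height is the first
free level, which receives a new value. This is `liftScan`, and the invariant `ScanState` makes it a
bijection (`ScanState.restricted_append_iff`, `ScanState.liftScan_injOn`). It agrees with iterated
lifting because a lift is needed exactly when a spent level is visited again, and that lift replaces
the spent value by the new one (`LiftState.isLift`, `LiftState.reflTransGen`).

For the enumeration, the recursion on height and flag is solved by series geometric in `h`, whose
ratio is a kernel root (`coeff_height_series`). -/

/-! ### Admissible height words and their number. -/

/-- Height words admissible after an upstep at height `h`; the flag records that the step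
to this height was a descent, after which an ascent is forbidden. -/
def HeightOK : Bool → ℕ → List ℕ → Prop
  | _, _, [] => True
  | st, h, b :: t => b < h + (if st then 1 else 2) ∧ HeightOK (decide (b < h)) b t

/-- The number of admissible height words of a given length. -/
def heightCount : ℕ → Bool → ℕ → ℕ
  | 0, _, _ => 1
  | n + 1, st, h =>
      ∑ b ∈ Finset.range (h + (if st then 1 else 2)), heightCount n (decide (b < h)) b

/-- The finite set of admissible height words of a given length. -/
def heightWords : ℕ → Bool → ℕ → Finset (List ℕ)
  | 0, _, _ => {[]}
  | n + 1, st, h => (Finset.range (h + (if st then 1 else 2))).biUnion fun b =>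
      (heightWords n (decide (b < h)) b).map ⟨List.cons b, List.cons_injective⟩

theorem mem_heightWords (n : ℕ) (st : Bool) (h : ℕ) (w : List ℕ) :
    w ∈ heightWords n st h ↔ w.length = n ∧ HeightOK st h w := by
  induction n generalizing st h w with
  | zero =>
    simp only [heightWords, Finset.mem_singleton, List.length_eq_zero_iff]
    exact ⟨fun e => ⟨e, by subst e; trivial⟩, fun e => e.1⟩
  | succ n ih =>
    simp only [heightWords, Finset.mem_biUnion, Finset.mem_range, Finset.mem_map,
      Function.Embedding.coeFn_mk, ih]
    constructor
    · rintro ⟨b, hb, t, ⟨hl, ht⟩, rfl⟩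
      exact ⟨by simp [hl], hb, ht⟩
    · rintro ⟨hl, hw⟩
      cases w with
      | nil => simp at hl
      | cons b t => exact ⟨b, hw.1, t, ⟨by simpa using hl, hw.2⟩, rfl⟩

theorem card_heightWords (n : ℕ) (st : Bool) (h : ℕ) :
    (heightWords n st h).card = heightCount n st h := by
  induction n generalizing st h with
  | zero => simp [heightWords, heightCount]
  | succ n ih =>
    rw [heightWords, heightCount, Finset.card_biUnion]
    · simp [ih]
    · intro a _ b _ hab
      simp only [Finset.disjoint_left, Finset.mem_map, Function.Embedding.coeFn_mk]
      rintro w ⟨t, _, rfl⟩ ⟨t', _, e⟩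
      exact hab (List.cons.inj e).1.symm

theorem heightCount_succ_true (n h : ℕ) :
    heightCount (n + 1) true h =
      ∑ b ∈ Finset.range h, heightCount n true b + heightCount n false h := by
  simp only [heightCount, if_true, Finset.sum_range_succ, lt_irrefl, decide_false]
  congr 1
  exact Finset.sum_congr rfl fun b hb => by simp [Finset.mem_range.1 hb]

theorem heightCount_succ_false (n h : ℕ) :
    heightCount (n + 1) false h = ∑ b ∈ Finset.range h, heightCount n true b
      + heightCount n false h + heightCount n false (h + 1) := by
  have : ¬ h + 1 < h := by omega
  simp only [heightCount, Finset.sum_range_succ, lt_irrefl, decide_false, this, reduceCtorEq,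
    if_false]
  congr 2
  exact Finset.sum_congr rfl fun b hb => by simp [Finset.mem_range.1 hb]

/-! ### The generating function. -/

-- With `u = 1 / (1 + X ^ 2)` and `l = u * m` the equation becomes `m = 1 + X * u ^ 2 * m ^ 2`,
-- which is the Catalan equation at `X * u ^ 2`.
open PowerSeries in
theorem exists_kernel_root :
    ∃ l : PowerSeries ℚ, constantCoeff l = 1 ∧ (1 + X ^ 2) * l = 1 + X * l ^ 2 := by
  have hu : constantCoeff (1 + X ^ 2 : PowerSeries ℚ) ≠ 0 := by simp
  set u : PowerSeries ℚ := (1 + X ^ 2)⁻¹ with hu'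
  have huu : (1 + X ^ 2) * u = 1 := PowerSeries.mul_inv_cancel _ hu
  have hsub : HasSubst (X * u ^ 2 : PowerSeries ℚ) :=
    HasSubst.of_constantCoeff_zero' (by simp)
  set c : PowerSeries ℚ := (catalanSeries.map (Nat.castRingHom ℚ)) with hc
  have hcat : c ^ 2 * (X : PowerSeries ℚ) + 1 = c := by
    have := congrArg (PowerSeries.map (Nat.castRingHom ℚ)) catalanSeries_sq_mul_X_add_one
    simpa [hc] using this
  set m : PowerSeries ℚ := c.subst (X * u ^ 2) with hm
  have hmm : m ^ 2 * (X * u ^ 2) + 1 = m := by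
    have h1 := congrArg (fun f : PowerSeries ℚ => substAlgHom hsub f) hcat
    simp only [map_add, map_mul, map_pow, map_one, substAlgHom_X] at h1
    simpa [hm, coe_substAlgHom] using h1
  refine ⟨u * m, ?_, ?_⟩
  · have h2 := congrArg constantCoeff hmm
    have h3 := congrArg constantCoeff huu
    simp at h2 h3
    simp [← h2, h3]
  · linear_combination m * huu - hmm

open PowerSeries in
theorem exists_height_series : ∃ g : PowerSeries ℚ,
    g = 1 - X + (2 * X - X ^ 2) * g + X ^ 2 * g ^ 2 := by
  obtain ⟨l, h1, h2⟩ := exists_kernel_root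
  obtain ⟨g, hg⟩ := X_dvd_iff.2 (show constantCoeff (l - 1) = 0 by simp [h1])
  obtain rfl : l = 1 + X * g := by linear_combination hg
  refine ⟨g, mul_left_cancel₀ (X_ne_zero (R := ℚ)) ?_⟩
  linear_combination h2

-- Kernel method: the ansatz `g * l ^ h`, `f * l ^ h` with `l = 1 + X * g` makes `X` times the sum
-- over lower heights telescope to `l ^ h - 1`. The two recursions then reduce to `g = 1 + X * f`
-- and `f = 1 + X * f + X * f * l`, independent of `h`.
open PowerSeries in
theorem coeff_height_series (g : PowerSeries ℚ)
    (hg : g = 1 - X + (2 * X - X ^ 2) * g + X ^ 2 * g ^ 2) (n h : ℕ) :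
    coeff (R := ℚ) n (g * (1 + X * g) ^ h) = (heightCount n true h : ℚ) ∧
    coeff (R := ℚ) n ((2 * g - 1 - X * g + X * g ^ 2) * (1 + X * g) ^ h) =
      (heightCount n false h : ℚ) := by
  set l := 1 + X * g with hl
  set f := 2 * g - 1 - X * g + X * g ^ 2 with hf
  have hgf : g = 1 + X * f := by rw [hf]; linear_combination hg
  have hff : f = X * f * l + X * f + 1 := by
    refine mul_left_cancel₀ (X_ne_zero (R := ℚ)) ?_
    rw [hl]
    linear_combination (X * (1 + X * g) + X - 1) * hgf + hg
  have hsum : ∀ h : ℕ, l ^ h = 1 + X * ∑ b ∈ Finset.range h, g * l ^ b := by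
    intro h
    rw [← Finset.mul_sum]
    have := mul_neg_geom_sum l h
    linear_combination this + (∑ b ∈ Finset.range h, l ^ b) * hl
  have hG : ∀ h : ℕ, g * l ^ h = 1 + X * (∑ b ∈ Finset.range h, g * l ^ b + f * l ^ h) := by
    intro h
    linear_combination hsum h + l ^ h * hgf
  have hF : ∀ h : ℕ, f * l ^ h =
      1 + X * (∑ b ∈ Finset.range h, g * l ^ b + f * l ^ h + f * l ^ (h + 1)) := by
    intro h
    linear_combination hsum h + l ^ h * hff
  induction n generalizing h with
  | zero =>
    refine ⟨(congrArg (coeff 0) (hG h)).trans ?_, (congrArg (coeff 0) (hF h)).trans ?_⟩ <;>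
      simp [heightCount]
  | succ n ih =>
    rw [heightCount_succ_true, heightCount_succ_false]
    refine ⟨(congrArg (coeff (n + 1)) (hG h)).trans ?_,
      (congrArg (coeff (n + 1)) (hF h)).trans ?_⟩ <;>
      simp [coeff_succ_X_mul, coeff_one, ih]

/-! ### Pattern avoidance tested letter by letter. -/

/-- The number of entries of `x` that are smaller than `a` orders the entries as they are. -/
theorem card_filter_lt_iff {s : Finset ℕ} {a b : ℕ} (ha : a ∈ s) :
    (s.filter (· < a)).card < (s.filter (· < b)).card ↔ a < b := by
  constructor
  · intro h
    by_contra hab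
    refine absurd (Finset.card_le_card (s := s.filter (· < b)) (t := s.filter (· < a)) ?_) (by omega)
    intro x
    simp only [Finset.mem_filter]
    exact fun hx => ⟨hx.1, by omega⟩
  · intro hab
    refine Finset.card_lt_card (Finset.ssubset_iff_of_subset ?_ |>.2 ⟨a, ?_, ?_⟩)
    · intro x
      simp only [Finset.mem_filter]
      exact fun hx => ⟨hx.1, by omega⟩
    · simp [ha, hab]
    · simp

theorem containsPattern_100_iff (x : List ℕ) :
    ContainsPattern x [1, 0, 0] ↔ ∃ y a, a < y ∧ [y, a, a].Sublist x := by
  constructor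
  · rintro ⟨z, hz, h⟩
    have hl : z.length = 3 := by simpa [reduction] using congrArg List.length h
    obtain ⟨p, q, r, rfl⟩ := List.length_eq_three.1 hl
    set s := [p, q, r].toFinset with hs
    simp only [reduction, List.map_cons, List.map_nil, List.cons.injEq, and_true, ← hs] at h
    have hp : p ∈ s := by simp [hs]
    have hq : q ∈ s := by simp [hs]
    have hr : r ∈ s := by simp [hs]
    have h1 := card_filter_lt_iff (b := p) hq
    have h2 := card_filter_lt_iff (b := r) hq
    have h3 := card_filter_lt_iff (b := q) hr
    obtain rfl : q = r := by omega
    exact ⟨p, q, by omega, hz⟩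
  · rintro ⟨y, a, h, hs⟩
    refine ⟨_, hs, ?_⟩
    have : ¬ y < a := by omega
    simp [reduction, Finset.filter_insert, Finset.filter_singleton, h, this]

theorem containsPattern_101_iff (x : List ℕ) :
    ContainsPattern x [1, 0, 1] ↔ ∃ y a, a < y ∧ [y, a, y].Sublist x := by
  constructor
  · rintro ⟨z, hz, h⟩
    have hl : z.length = 3 := by simpa [reduction] using congrArg List.length h
    obtain ⟨p, q, r, rfl⟩ := List.length_eq_three.1 hl
    set s := [p, q, r].toFinset with hs
    simp only [reduction, List.map_cons, List.map_nil, List.cons.injEq, and_true, ← hs] at h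
    have hp : p ∈ s := by simp [hs]
    have hq : q ∈ s := by simp [hs]
    have hr : r ∈ s := by simp [hs]
    have h1 := card_filter_lt_iff (b := p) hq
    have h2 := card_filter_lt_iff (b := r) hp
    have h3 := card_filter_lt_iff (b := p) hr
    obtain rfl : p = r := by omega
    exact ⟨p, q, by omega, hz⟩
  · rintro ⟨y, a, h, hs⟩
    refine ⟨_, hs, ?_⟩
    have : ¬ y < a := by omega
    simp [reduction, Finset.filter_insert, Finset.filter_singleton, h, this]

theorem sublist_concat_concat_iff {l q : List ℕ} {a v : ℕ} :
    (l ++ [a]).Sublist (q ++ [v]) ↔ (l ++ [a]).Sublist q ∨ (a = v ∧ l.Sublist q) := by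
  rw [← List.reverse_sublist, ← List.reverse_sublist (l₂ := q), ← List.reverse_sublist (l₁ := l)]
  simp only [List.reverse_append, List.reverse_cons, List.reverse_nil, List.nil_append,
    List.singleton_append, List.sublist_cons_iff, List.cons.injEq]
  constructor
  · rintro (h | ⟨r, ⟨rfl, rfl⟩, h⟩)
    · exact Or.inl h
    · exact Or.inr ⟨rfl, h⟩
  · rintro (h | ⟨rfl, h⟩)
    · exact Or.inl h
    · exact Or.inr ⟨_, ⟨rfl, rfl⟩, h⟩

theorem pair_sublist_concat_iff {q : List ℕ} {y a v : ℕ} :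
    [y, a].Sublist (q ++ [v]) ↔ [y, a].Sublist q ∨ (a = v ∧ y ∈ q) := by
  simpa using sublist_concat_concat_iff (l := [y]) (a := a) (q := q) (v := v)

theorem triple_sublist_concat_iff {q : List ℕ} {x y a v : ℕ} :
    [x, y, a].Sublist (q ++ [v]) ↔ [x, y, a].Sublist q ∨ (a = v ∧ [x, y].Sublist q) :=
  sublist_concat_concat_iff (l := [x, y])

/-- The smallest value exceeding all entries. -/
def nextVal (q : List ℕ) : ℕ := q.foldr (fun x m => max (x + 1) m) 0

theorem lt_nextVal_of_mem {q : List ℕ} {x : ℕ} (hx : x ∈ q) : x < nextVal q := by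
  induction q with
  | nil => simp at hx
  | cons b t ih =>
    rcases List.mem_cons.1 hx with rfl | h
    · simp [nextVal]
    · exact (ih h).trans_le (le_max_right _ _)

theorem nextVal_concat (q : List ℕ) (a : ℕ) : nextVal (q ++ [a]) = max (nextVal q) (a + 1) := by
  induction q with
  | nil => simp [nextVal]
  | cons b t ih =>
    simp only [nextVal, List.cons_append, List.foldr_cons] at ih ⊢
    rw [ih, max_assoc]

/-- An old value `a` may be appended to `q` without creating a copy of `100` or `101`. -/
def Reusable (q : List ℕ) (a : ℕ) : Prop :=
  a ∈ q ∧ (∀ y, a < y → ¬ [y, a].Sublist q) ∧ ∀ y, y < a → ¬ [a, y].Sublist q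

/-- Words built letter by letter, each letter being either the next unused value
or an old value whose repetition creates no copy of `100` or `101`. -/
inductive Restricted : List ℕ → Prop
  | nil : Restricted []
  | snoc {q : List ℕ} {a : ℕ} :
      Restricted q → (a = nextVal q ∨ Reusable q a) → Restricted (q ++ [a])

theorem restricted_concat_iff {q : List ℕ} {a : ℕ} :
    Restricted (q ++ [a]) ↔ Restricted q ∧ (a = nextVal q ∨ Reusable q a) := by
  refine ⟨fun h => ?_, fun h => .snoc h.1 h.2⟩
  generalize hx : q ++ [a] = x at h
  cases h with
  | nil => simp at hx
  | snoc h1 h2 =>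
    obtain ⟨rfl, e⟩ := List.append_inj' hx rfl
    obtain rfl : a = _ := by simpa using e
    exact ⟨h1, h2⟩

theorem Restricted.of_append {q t : List ℕ} (h : Restricted (q ++ t)) : Restricted q := by
  induction t using List.reverseRecOn with
  | nil => simpa using h
  | append_singleton t a ih =>
    rw [← List.append_assoc, restricted_concat_iff] at h
    exact ih h.1

theorem numAscents_concat (q : List ℕ) (a : ℕ) (hq : q ≠ []) :
    numAscents (q ++ [a]) = numAscents q + if q.getLast hq < a then 1 else 0 := by
  have hl : 0 < q.length := List.length_pos_iff.2 hq
  obtain ⟨m, hm⟩ : ∃ m, q.length = m + 1 := ⟨q.length - 1, by omega⟩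
  have e1 : (q ++ [a]).length - 1 = m + 1 := by simp [hm]
  have e2 : q.length - 1 = m := by omega
  have e3 : (q ++ [a]).getD m 0 = q.getLast hq := by
    rw [List.getD_append _ _ _ _ (by omega), List.getLast_eq_getElem,
      List.getD_eq_getElem _ _ (by omega)]
    simp [e2]
  have e4 : (q ++ [a]).getD (m + 1) 0 = a := by
    rw [List.getD_append_right _ _ _ _ (by omega)]
    simp [hm]
  rw [numAscents, numAscents, e1, e2, Finset.range_add_one, Finset.filter_insert, e3, e4]
  have e5 : (Finset.range m).filter (fun j => (q ++ [a]).getD j 0 < (q ++ [a]).getD (j + 1) 0)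
      = (Finset.range m).filter (fun j => q.getD j 0 < q.getD (j + 1) 0) := by
    refine Finset.filter_congr fun j hj => ?_
    have := Finset.mem_range.1 hj
    rw [List.getD_append _ _ _ _ (by omega), List.getD_append _ _ _ _ (by omega)]
  rw [e5]
  split_ifs
  · rw [Finset.card_insert_of_notMem (by simp)]
  · rfl

theorem isAscentSequence_concat_iff (q : List ℕ) (a : ℕ) :
    IsAscentSequence (q ++ [a]) ↔ IsAscentSequence q ∧ (q = [] → a = 0) ∧
      (q ≠ [] → a ≤ numAscents q + 1) := by
  have key : ∀ i, i < q.length →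
      (q ++ [a]).getD i 0 = q.getD i 0 ∧ (q ++ [a]).take i = q.take i := fun i hi =>
    ⟨List.getD_append _ _ _ _ hi, List.take_append_of_le_length hi.le⟩
  have hlast : (q ++ [a]).getD q.length 0 = a := by
    rw [List.getD_append_right _ _ _ _ le_rfl]; simp
  have htake : (q ++ [a]).take q.length = q := by simp
  constructor
  · rintro ⟨h1, h2⟩
    refine ⟨⟨fun hl => ?_, fun i h0 hi => ?_⟩, ?_, fun hq => ?_⟩
    · rw [← (key 0 hl).1]; exact h1 (by simp)
    · rw [← (key i hi).1, ← (key i hi).2]; exact h2 i h0 (by simp; omega)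
    · rintro rfl
      simpa using h1 (by simp)
    · have := h2 q.length (List.length_pos_iff.2 hq) (by simp)
      rwa [hlast, htake] at this
  · rintro ⟨⟨h1, h2⟩, h3, h4⟩
    refine ⟨fun _ => ?_, fun i h0 hi => ?_⟩
    · rcases eq_or_ne q [] with rfl | hq
      · simpa using h3 rfl
      · have hl := List.length_pos_iff.2 hq
        rw [(key 0 hl).1]; exact h1 hl
    · rcases Nat.lt_or_ge i q.length with h | h
      · rw [(key i h).1, (key i h).2]; exact h2 i h0 h
      · obtain rfl : i = q.length := by simp at hi; omega
        rw [hlast, htake]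
        exact h4 (List.length_pos_iff.1 h0)

/-- Ascent sequences avoiding `100` and `101`. -/
def AvoidingAscent (x : List ℕ) : Prop :=
  IsAscentSequence x ∧ (∀ y a, a < y → ¬ [y, a, a].Sublist x) ∧
    ∀ y a, a < y → ¬ [y, a, y].Sublist x

theorem mem_ascentAvoiders_iff (n : ℕ) (x : List ℕ) :
    x ∈ ascentAvoiders {[1, 0, 0], [1, 0, 1]} n ↔ x.length = n ∧ AvoidingAscent x := by
  simp only [ascentAvoiders, Set.mem_ofPred_eq, Set.mem_insert_iff, Set.mem_singleton_iff,
    forall_eq_or_imp, forall_eq, containsPattern_100_iff, containsPattern_101_iff, AvoidingAscent]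
  push Not
  rfl

theorem avoidingAscent_concat_iff (q : List ℕ) (a : ℕ) :
    AvoidingAscent (q ++ [a]) ↔ AvoidingAscent q ∧ (q = [] → a = 0) ∧
      (q ≠ [] → a ≤ numAscents q + 1) ∧ (∀ y, a < y → ¬ [y, a].Sublist q) ∧
      ∀ y, y < a → ¬ [a, y].Sublist q := by
  simp only [AvoidingAscent, isAscentSequence_concat_iff, triple_sublist_concat_iff]
  constructor
  · rintro ⟨⟨h1, h2, h3⟩, h4, h5⟩
    exact ⟨⟨h1, fun y b hb hs => h4 y b hb (.inl hs), fun y b hb hs => h5 y b hb (.inl hs)⟩,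
      h2, h3, fun y hb hs => h4 y a hb (.inr ⟨rfl, hs⟩), fun y hb hs => h5 a y hb (.inr ⟨rfl, hs⟩)⟩
  · rintro ⟨⟨h1, h4, h5⟩, h2, h3, h6, h7⟩
    refine ⟨⟨h1, h2, h3⟩, ?_, ?_⟩
    · rintro y b hb (hs | ⟨rfl, hs⟩)
      · exact h4 y b hb hs
      · exact h6 y hb hs
    · rintro y b hb (hs | ⟨rfl, hs⟩)
      · exact h5 y b hb hs
      · exact h7 b hb hs

theorem pair_getLast_sublist {q : List ℕ} (hq : q ≠ []) {a : ℕ} (ha : a ∈ q)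
    (hne : a ≠ q.getLast hq) : [a, q.getLast hq].Sublist q := by
  have e := List.dropLast_append_getLast hq
  set l := q.getLast hq
  rw [← e] at ha ⊢
  rw [pair_sublist_concat_iff]
  refine .inr ⟨rfl, ?_⟩
  rcases List.mem_append.1 ha with h | h
  · exact h
  · exact absurd (List.mem_singleton.1 h) hne

/-- Restricted words use an initial segment of values and have one ascent
for each nonzero value. -/
theorem Restricted.mem_and_numAscents {x : List ℕ} (h : Restricted x) :
    (∀ y < nextVal x, y ∈ x) ∧ (x ≠ [] → numAscents x + 1 = nextVal x) := by
  induction h with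
  | nil => simp [nextVal]
  | @snoc q a hq ha ih =>
    rw [nextVal_concat]
    refine ⟨fun y hy => ?_, fun _ => ?_⟩
    · rcases lt_or_ge y (nextVal q) with h | h
      · exact List.mem_append_left _ (ih.1 y h)
      · rcases ha with rfl | ha
        · obtain rfl : y = nextVal q := by omega
          simp
        · have := lt_nextVal_of_mem ha.1
          omega
    · rcases eq_or_ne q [] with rfl | hne
      · rcases ha with rfl | ha
        · simp [numAscents, nextVal]
        · simp [Reusable] at ha
      · rw [numAscents_concat q a hne]
        have h2 := ih.2 hne
        rcases ha with rfl | ha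
        · have := lt_nextVal_of_mem (List.getLast_mem hne)
          rw [if_pos this]
          omega
        · have h3 := lt_nextVal_of_mem ha.1
          -- An ascent to an old value `a` would complete a `101` whose middle letter is the last
          -- letter of `q`.
          have : ¬ q.getLast hne < a := fun hlt =>
            ha.2.2 _ hlt (pair_getLast_sublist hne ha.1 hlt.ne')
          rw [if_neg this]
          omega

theorem mem_of_pair_sublist_left {q : List ℕ} {a b : ℕ} (h : [a, b].Sublist q) : a ∈ q :=
  h.subset (by simp)

theorem mem_of_pair_sublist_right {q : List ℕ} {a b : ℕ} (h : [a, b].Sublist q) : b ∈ q :=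
  h.subset (by simp)

/-- All values below `nextVal q` occur in `q`, and for nonempty `q` the ascent bound equals `nextVal
q`, so a letter not in `q` can only be `nextVal q`. -/
theorem avoidingAscent_iff_restricted (x : List ℕ) : AvoidingAscent x ↔ Restricted x := by
  induction x using List.reverseRecOn with
  | nil =>
    exact ⟨fun _ => .nil, fun _ => ⟨⟨by simp, by simp⟩, by simp, by simp⟩⟩
  | append_singleton q a ih =>
    rw [avoidingAscent_concat_iff, restricted_concat_iff, ih]
    refine and_congr_right fun hq => ?_
    obtain ⟨h1, h2⟩ := hq.mem_and_numAscents
    constructor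
    · rintro ⟨e0, e1, e2, e3⟩
      by_cases ha : a ∈ q
      · exact .inr ⟨ha, e2, e3⟩
      · left
        have h3 : nextVal q ≤ a := not_lt.1 fun h => ha (h1 a h)
        rcases eq_or_ne q [] with rfl | hne
        · simp [e0, nextVal]
        · have := h2 hne
          have := e1 hne
          omega
    · rintro (rfl | ⟨ha, e2, e3⟩)
      · refine ⟨?_, fun hne => (h2 hne).ge, fun y hy hs => ?_, fun y hy hs => ?_⟩
        · rintro rfl; rfl
        · exact (lt_nextVal_of_mem (mem_of_pair_sublist_right hs)).false
        · exact (lt_nextVal_of_mem (mem_of_pair_sublist_left hs)).false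
      · refine ⟨?_, fun hne => ?_, e2, e3⟩
        · rintro rfl; simp at ha
        · have := lt_nextVal_of_mem ha
          have := h2 hne
          omega

/-! ### The scan and its stack of reusable values. -/

/-- The word obtained from a height word by performing all lifts in one scan. `F b` is the
current value at height `b`, and `N` is the next unused value. -/
def liftScan : (ℕ → ℕ) → ℕ → Bool → ℕ → List ℕ → List ℕ
  | _, _, _, _, [] => []
  | F, N, st, h, b :: t =>
      if b < h ∨ (b = h ∧ st = false) then F b :: liftScan F N (decide (b < h)) b t
      else N :: liftScan (Function.update F b N) (N + 1) false b t

theorem length_liftScan (F : ℕ → ℕ) (N : ℕ) (st : Bool) (h : ℕ) (w : List ℕ) :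
    (liftScan F N st h w).length = w.length := by
  induction w generalizing F N st h with
  | nil => rfl
  | cons b t ih => rw [liftScan]; split_ifs <;> simp [ih]

/-- The state of `liftScan` describes the word `p` read so far. -/
structure ScanState (F : ℕ → ℕ) (N : ℕ) (st : Bool) (h : ℕ) (p : List ℕ) : Prop where
  restricted : Restricted p
  next : N = nextVal p
  strictMono : ∀ b c, b < c → (c < h ∨ (c = h ∧ st = false)) → F b < F c
  reusable : ∀ a, Reusable p a ↔ ∃ b, (b < h ∨ (b = h ∧ st = false)) ∧ a = F b
  exists_larger : ∀ b < h, ∃ x ∈ p, F b < x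
  le_top : st = false → ∀ x ∈ p, x ≤ F h

theorem scanState_nil (F : ℕ → ℕ) : ScanState F 0 true 0 [] where
  restricted := .nil
  next := rfl
  strictMono := by simp
  reusable := by simp [Reusable]
  exists_larger := by simp
  le_top := by simp

/-- If `a` is an old value above `v`, then `a`, `v` and a further `a` would form a `101`. -/
theorem reusable_concat_iff {p : List ℕ} {v a : ℕ} (hv : a ≠ v) :
    Reusable (p ++ [v]) a ↔ Reusable p a ∧ a < v := by
  simp only [Reusable, pair_sublist_concat_iff, List.mem_append, List.mem_singleton]
  constructor
  · rintro ⟨h1, h2, h3⟩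
    have ha : a ∈ p := h1.resolve_right hv
    refine ⟨⟨ha, fun y hy hs => h2 y hy (.inl hs), fun y hy hs => h3 y hy (.inl hs)⟩, ?_⟩
    by_contra hlt
    exact h3 v (by omega) (.inr ⟨rfl, ha⟩)
  · rintro ⟨⟨h1, h2, h3⟩, h4⟩
    refine ⟨.inl h1, ?_, ?_⟩
    · rintro y hy (hs | ⟨rfl, -⟩)
      · exact h2 y hy hs
      · exact hv rfl
    · rintro y hy (hs | ⟨rfl, -⟩)
      · exact h3 y hy hs
      · omega

/-- An entry of `p` above `v`, the appended `v` and a further `v` would form a `100`. -/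
theorem reusable_concat_self_iff {p : List ℕ} {v : ℕ} (hv : v = nextVal p ∨ Reusable p v) :
    Reusable (p ++ [v]) v ↔ ∀ x ∈ p, x ≤ v := by
  simp only [Reusable, pair_sublist_concat_iff, List.mem_append, List.mem_singleton]
  constructor
  · rintro ⟨-, h2, -⟩ x hx
    by_contra hlt
    exact h2 x (by omega) (.inr ⟨by simp, hx⟩)
  · intro hle
    refine ⟨.inr trivial, ?_, ?_⟩
    · rintro y hy (hs | ⟨-, hs⟩)
      · have := hle y (mem_of_pair_sublist_left hs); omega
      · have := hle y hs; omega
    · rintro y hy (hs | ⟨rfl, -⟩)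
      · rcases hv with rfl | hv
        · exact (lt_nextVal_of_mem (mem_of_pair_sublist_left hs)).false
        · exact hv.2.2 y hy hs
      · omega

theorem ScanState.lt_next {F : ℕ → ℕ} {N : ℕ} {st : Bool} {h : ℕ} {p : List ℕ}
    (S : ScanState F N st h p) {b : ℕ} (hb : b < h ∨ (b = h ∧ st = false)) : F b < N := by
  rw [S.next]
  exact lt_nextVal_of_mem ((S.reusable _).2 ⟨b, hb, rfl⟩).1

/-- Lower stack values survive and higher ones are lost to `101`. The value `F b` itself survives
only if nothing larger precedes it, that is, if `b = h`; after a descent it is lost to `100`. -/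
theorem ScanState.reuse {F : ℕ → ℕ} {N : ℕ} {st : Bool} {h : ℕ} {p : List ℕ}
    (S : ScanState F N st h p) {b : ℕ} (hb : b < h ∨ (b = h ∧ st = false)) :
    ScanState F N (decide (b < h)) b (p ++ [F b]) := by
  have hr : Reusable p (F b) := (S.reusable _).2 ⟨b, hb, rfl⟩
  have hbh : b ≤ h := by omega
  have hav : ∀ c, c < b → (c < h ∨ (c = h ∧ st = false)) := fun c hc => .inl (by omega)
  refine ⟨.snoc S.restricted (.inr hr), ?_, ?_, ?_, ?_, ?_⟩
  · rw [nextVal_concat, ← S.next]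
    have := S.lt_next hb
    omega
  · rintro c d hcd (hd | ⟨rfl, -⟩)
    · exact S.strictMono c d hcd (hav d hd)
    · exact S.strictMono c d hcd hb
  · intro a
    by_cases ha : a = F b
    · subst ha
      rw [reusable_concat_self_iff (.inr hr)]
      constructor
      · intro hle
        refine ⟨b, .inr ⟨rfl, ?_⟩, rfl⟩
        simp only [decide_eq_false_iff_not]
        intro hlt
        obtain ⟨x, hx, hlx⟩ := S.exists_larger b hlt
        exact absurd (hle x hx) (by omega)
      · rintro ⟨c, hc | ⟨rfl, hc⟩, e⟩
        · exact absurd (S.strictMono c b hc hb) (by omega)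
        · simp only [decide_eq_false_iff_not] at hc
          obtain ⟨rfl, hst⟩ := hb.resolve_left hc
          exact S.le_top hst
    · rw [reusable_concat_iff ha, S.reusable]
      constructor
      · rintro ⟨⟨c, hc, rfl⟩, hlt⟩
        refine ⟨c, .inl ?_, rfl⟩
        by_contra hcb
        have : c ≠ b := by rintro rfl; exact ha rfl
        exact absurd (S.strictMono b c (by omega) hc) (by omega)
      · rintro ⟨c, hc | ⟨rfl, hc⟩, rfl⟩
        · exact ⟨⟨c, hav c hc, rfl⟩, S.strictMono c b hc hb⟩
        · exact absurd rfl ha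
  · intro c hc
    exact ⟨F b, by simp, S.strictMono c b hc hb⟩
  · intro hst x hx
    simp only [decide_eq_false_iff_not] at hst
    obtain ⟨rfl, hst'⟩ := hb.resolve_left hst
    rcases List.mem_append.1 hx with h | h
    · exact S.le_top hst' x h
    · exact (List.mem_singleton.1 h).le

/-- The new value exceeds every entry, so it invalidates nothing and goes on top of the stack. The
first free level is `h` if the flag marks `F h` as spent, and `h + 1` otherwise. -/
theorem ScanState.new {F : ℕ → ℕ} {N : ℕ} {st : Bool} {h : ℕ} {p : List ℕ}
    (S : ScanState F N st h p) {b : ℕ} (hb : b = if st then h else h + 1) :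
    ScanState (Function.update F b N) (N + 1) false b (p ++ [N]) := by
  have hav : ∀ c, c < b ↔ (c < h ∨ (c = h ∧ st = false)) := by
    intro c
    cases st <;> simp at hb ⊢ <;> omega
  have hF : ∀ c, c < b → Function.update F b N c = F c := fun c hc =>
    Function.update_of_ne hc.ne _ _
  have hp : ∀ x ∈ p, x < N := fun x hx => by rw [S.next]; exact lt_nextVal_of_mem hx
  refine ⟨.snoc S.restricted (.inl S.next), ?_, ?_, ?_, ?_, ?_⟩
  · rw [nextVal_concat, ← S.next]; omega
  · rintro c d hcd (hd | ⟨rfl, -⟩)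
    · rw [hF c (by omega), hF d hd]
      exact S.strictMono c d hcd ((hav d).1 hd)
    · rw [hF c hcd, Function.update_self]
      exact S.lt_next ((hav c).1 hcd)
  · intro a
    by_cases ha : a = N
    · subst ha
      rw [reusable_concat_self_iff (.inl S.next)]
      exact ⟨fun _ => ⟨b, .inr ⟨rfl, rfl⟩, by simp⟩, fun _ x hx => (hp x hx).le⟩
    · rw [reusable_concat_iff ha, S.reusable]
      constructor
      · rintro ⟨⟨c, hc, rfl⟩, hlt⟩
        have hc' := (hav c).2 hc
        exact ⟨c, .inl hc', (hF c hc').symm⟩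
      · rintro ⟨c, hc | ⟨rfl, -⟩, rfl⟩
        · rw [hF c hc]
          exact ⟨⟨c, (hav c).1 hc, rfl⟩, S.lt_next ((hav c).1 hc)⟩
        · simp at ha
  · intro c hc
    exact ⟨N, by simp, by rw [hF c hc]; exact S.lt_next ((hav c).1 hc)⟩
  · intro _ x hx
    rw [Function.update_self]
    rcases List.mem_append.1 hx with h | h
    · exact (hp x h).le
    · exact (List.mem_singleton.1 h).le

/-- The two alternatives are the two branches of `liftScan`, with the matching next flag. -/
theorem heightOK_cons_iff {st : Bool} {h b : ℕ} {t : List ℕ} :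
    HeightOK st h (b :: t) ↔
      ((b < h ∨ (b = h ∧ st = false)) ∧ HeightOK (decide (b < h)) b t) ∨
      ((b = if st then h else h + 1) ∧ HeightOK false b t) := by
  rw [HeightOK]
  rcases lt_trichotomy b h with hb | rfl | hb
  · have : b ≠ if st then h else h + 1 := by split_ifs <;> omega
    have h2 : b < h + if st then 1 else 2 := by split_ifs <;> omega
    simp [hb, this, h2]
  · cases st <;> simp
  · have h1 : ¬ b < h := by omega
    have h2 : b ≠ h := by omega
    cases st <;> simp [h1, h2]
    all_goals intro; omega

/-- The words produced by `liftScan` are exactly the continuations to restricted words. -/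
theorem ScanState.restricted_append_iff {F : ℕ → ℕ} {N : ℕ} {st : Bool} {h : ℕ} {p : List ℕ}
    (S : ScanState F N st h p) (v : List ℕ) :
    Restricted (p ++ v) ↔ ∃ w, HeightOK st h w ∧ liftScan F N st h w = v := by
  induction v generalizing F N st h p with
  | nil =>
    refine ⟨fun _ => ⟨[], trivial, rfl⟩, fun _ => by simpa using S.restricted⟩
  | cons a t ih =>
    have hneg : ∀ b, (b = if st then h else h + 1) → ¬ (b < h ∨ (b = h ∧ st = false)) := by
      intro b hb
      cases st <;> simp at hb ⊢ <;> omega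
    rw [List.append_cons]
    constructor
    · intro hr
      rcases (restricted_concat_iff.1 hr.of_append).2 with ha | ha
      · rw [← S.next] at ha
        subst ha
        obtain ⟨w, hw, e⟩ := (ih (S.new rfl)).1 hr
        refine ⟨_ :: w, heightOK_cons_iff.2 (.inr ⟨rfl, hw⟩), ?_⟩
        rw [liftScan, if_neg (hneg _ rfl), e]
      · obtain ⟨b, hb, rfl⟩ := (S.reusable a).1 ha
        obtain ⟨w, hw, e⟩ := (ih (S.reuse hb)).1 hr
        refine ⟨b :: w, heightOK_cons_iff.2 (.inl ⟨hb, hw⟩), ?_⟩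
        rw [liftScan, if_pos hb, e]
    · rintro ⟨w, hw, e⟩
      cases w with
      | nil => simp [liftScan] at e
      | cons b w =>
        rcases heightOK_cons_iff.1 hw with ⟨hb, hw⟩ | ⟨hb, hw⟩
        · rw [liftScan, if_pos hb, List.cons.injEq] at e
          obtain ⟨rfl, e⟩ := e
          exact (ih (S.reuse hb)).2 ⟨w, hw, e⟩
        · rw [liftScan, if_neg (hneg b hb), List.cons.injEq] at e
          obtain ⟨rfl, e⟩ := e
          exact (ih (S.new hb)).2 ⟨w, hw, e⟩

/-- Each output letter reveals the height read: stack values are strictly increasing in the level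
and smaller than `N`, and `N` is written for one admissible height only. -/
theorem ScanState.liftScan_injOn {F : ℕ → ℕ} {N : ℕ} {st : Bool} {h : ℕ} {p : List ℕ}
    (S : ScanState F N st h p) {w w' : List ℕ} (hw : HeightOK st h w) (hw' : HeightOK st h w')
    (e : liftScan F N st h w = liftScan F N st h w') : w = w' := by
  induction w generalizing F N st h p w' with
  | nil =>
    have := congrArg List.length e
    rw [length_liftScan, length_liftScan] at this
    exact (List.length_eq_zero_iff.1 this.symm).symm
  | cons b t ih =>
    cases w' with
    | nil => simpa [length_liftScan] using congrArg List.length e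
    | cons c t' =>
      have hneg : ∀ b, (b = if st then h else h + 1) → ¬ (b < h ∨ (b = h ∧ st = false)) := by
        intro b hb
        cases st <;> simp at hb ⊢ <;> omega
      rcases heightOK_cons_iff.1 hw with ⟨hb, hw⟩ | ⟨hb, hw⟩ <;>
      rcases heightOK_cons_iff.1 hw' with ⟨hc, hw'⟩ | ⟨hc, hw'⟩
      · rw [liftScan, if_pos hb, liftScan, if_pos hc, List.cons.injEq] at e
        obtain rfl : b = c := by
          rcases lt_trichotomy b c with hlt | h | hlt
          · exact absurd (S.strictMono b c hlt hc) (by omega)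
          · exact h
          · exact absurd (S.strictMono c b hlt hb) (by omega)
        rw [ih (S.reuse hb) hw hw' e.2]
      · rw [liftScan, if_pos hb, liftScan, if_neg (hneg c hc), List.cons.injEq] at e
        exact absurd (S.lt_next hb) (by omega)
      · rw [liftScan, if_neg (hneg b hb), liftScan, if_pos hc, List.cons.injEq] at e
        exact absurd (S.lt_next hc) (by omega)
      · rw [liftScan, if_neg (hneg b hb), liftScan, if_neg (hneg c hc), List.cons.injEq] at e
        obtain rfl : b = c := by omega
        rw [ih (S.new hb) hw hw' e.2]

/-! ### The scan as a sequence of lifts. -/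

/-- The current values of the unread part of a height word, when `F b` is the current value at
height `b`, and entries at larger heights have been raised along with the lowest height
`≤ h` that they have not left since. -/
def raised : (ℕ → ℕ) → ℕ → List ℕ → List ℕ
  | _, _, [] => []
  | F, h, b :: t => (F (min h b) + (b - min h b)) :: raised F (min h b) t

theorem raised_congr {F G : ℕ → ℕ} {h : ℕ} (hFG : ∀ c ≤ h, F c = G c) (t : List ℕ) :
    raised F h t = raised G h t := by
  induction t generalizing h with
  | nil => rfl
  | cons b t ih =>
    rw [raised, raised, hFG _ (min_le_left _ _),
      ih fun c hc => hFG c (hc.trans (min_le_left _ _))]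

/-- Heights from `h + 1` on get the same shift whether they are measured from level `h` or from
level `h + 1`. -/
theorem raised_succ {F : ℕ → ℕ} {h : ℕ} (hF : F (h + 1) = F h + 1) (t : List ℕ) :
    raised F (h + 1) t = raised F h t := by
  induction t with
  | nil => rfl
  | cons b t ih =>
    rw [raised, raised]
    rcases Nat.lt_or_ge h b with hb | hb
    · rw [min_eq_left (by omega), min_eq_left (by omega), hF, ih]
      congr 1
      omega
    · rw [min_eq_right (by omega), min_eq_right (by omega)]

theorem raised_zero {F : ℕ → ℕ} (hF : F 0 = 0) (t : List ℕ) : raised F 0 t = t := by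
  induction t with
  | nil => rfl
  | cons b t ih => simp [raised, hF, ih]

/-- The block of entries `≥ F h` ends exactly where the height first drops below `h`, since values
at lower levels are smaller than `F h`. Beyond that point level `h` is no longer consulted. -/
theorem lift_raised {F : ℕ → ℕ} {h N : ℕ} (hmono : ∀ b < h, F b < F h) (hN : F h ≤ N)
    (t : List ℕ) :
    ((raised F h t).takeWhile (fun b => F h ≤ b)).map (· + (N - F h))
      ++ (raised F h t).dropWhile (fun b => F h ≤ b) = raised (Function.update F h N) h t := by
  induction t with
  | nil => rfl
  | cons b t ih =>
    rw [raised, raised]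
    rcases Nat.lt_or_ge b h with hb | hb
    · have h1 := hmono b hb
      have h2 : ¬ F h ≤ F b := by omega
      simp only [min_eq_right hb.le, Nat.sub_self, Nat.add_zero]
      rw [List.takeWhile_cons_of_neg (by simpa using h1),
        List.dropWhile_cons_of_neg (by simpa using h1), Function.update_of_ne hb.ne]
      simp only [List.map_nil, List.nil_append]
      congr 1
      exact raised_congr (fun c hc => (Function.update_of_ne (by omega) _ _).symm) t
    · simp only [min_eq_left hb, Function.update_self]
      rw [List.takeWhile_cons_of_pos (by simp), List.dropWhile_cons_of_pos (by simp),
        List.map_cons, List.cons_append, ih]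
      congr 1
      omega

theorem pair_sublist_iff_exists_getD {p : List ℕ} {y a : ℕ} :
    [y, a].Sublist p ↔ ∃ i j, i < j ∧ j < p.length ∧ p.getD i 0 = y ∧ p.getD j 0 = a := by
  induction p using List.reverseRecOn with
  | nil => simp
  | append_singleton q v ih =>
    rw [pair_sublist_concat_iff, ih]
    have hq : ∀ i, i < q.length → (q ++ [v]).getD i 0 = q.getD i 0 := fun i hi =>
      List.getD_append _ _ _ _ hi
    have hv : (q ++ [v]).getD q.length 0 = v := by
      rw [List.getD_append_right _ _ _ _ le_rfl]; simp
    constructor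
    · rintro (⟨i, j, hij, hj, h1, h2⟩ | ⟨rfl, hy⟩)
      · exact ⟨i, j, hij, by simp; omega, by rwa [hq i (by omega)], by rwa [hq j hj]⟩
      · obtain ⟨i, hi, rfl⟩ := List.mem_iff_getElem.1 hy
        refine ⟨i, q.length, hi, by simp, ?_, hv⟩
        rw [hq i hi, List.getD_eq_getElem _ _ hi]
    · rintro ⟨i, j, hij, hj, h1, h2⟩
      rcases Nat.lt_or_ge j q.length with h | h
      · rw [hq i (by omega)] at h1
        rw [hq j h] at h2
        exact .inl ⟨i, j, hij, h, h1, h2⟩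
      · obtain rfl : j = q.length := by simp at hj; omega
        rw [hv] at h2
        rw [hq i hij, List.getD_eq_getElem _ _ hij] at h1
        exact .inr ⟨h2.symm, h1 ▸ List.getElem_mem hij⟩

theorem copy100EndsAt_iff {p s : List ℕ} {a : ℕ} :
    Copy100EndsAt (p ++ a :: s) p.length ↔ ∃ y, a < y ∧ [y, a].Sublist p := by
  have hp : ∀ i, i < p.length → (p ++ a :: s).getD i 0 = p.getD i 0 := fun i hi =>
    List.getD_append _ _ _ _ hi
  have ha : (p ++ a :: s).getD p.length 0 = a := by
    rw [List.getD_append_right _ _ _ _ le_rfl]; simp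
  simp only [Copy100EndsAt, ha, pair_sublist_iff_exists_getD]
  constructor
  · rintro ⟨i, j, hij, hj, -, h1, h2⟩
    rw [hp j hj] at h1 h2
    rw [hp i (hij.trans hj)] at h2
    exact ⟨_, h1 ▸ h2, i, j, hij, hj, rfl, h1⟩
  · rintro ⟨y, hy, i, j, hij, hj, rfl, rfl⟩
    refine ⟨i, j, hij, hj, by simp, hp j hj, ?_⟩
    rwa [hp j hj, hp i (hij.trans hj)]

/-- No copy of `100` ends inside a restricted prefix. -/
theorem Restricted.not_copy100EndsAt {p s : List ℕ} (hp : Restricted p) {k : ℕ}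
    (hk : k < p.length) : ¬ Copy100EndsAt (p ++ s) k := by
  have e : p ++ s = p.take k ++ p[k] :: (p.drop (k + 1) ++ s) := by
    rw [← List.cons_append, List.getElem_cons_drop, ← List.append_assoc, List.take_append_drop]
  have hr : Restricted (p.take k ++ [p[k]]) := by
    refine Restricted.of_append (t := p.drop (k + 1)) ?_
    rwa [List.append_assoc, List.singleton_append, List.getElem_cons_drop, List.take_append_drop]
  have hl : (p.take k).length = k := by simp; omega
  intro hc
  rw [e] at hc
  -- The fourth `k` is the index at which the copy ends.
  nth_rewrite 4 [← hl] at hc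
  obtain ⟨y, hy, hs⟩ := copy100EndsAt_iff.1 hc
  rcases (restricted_concat_iff.1 hr).2 with h | h
  · have := lt_nextVal_of_mem (mem_of_pair_sublist_right hs)
    omega
  · exact h.2.1 y hy hs

theorem foldr_max_add_one {p : List ℕ} (hp : p ≠ []) : p.foldr max 0 + 1 = nextVal p := by
  induction p with
  | nil => exact absurd rfl hp
  | cons b t ih =>
    rcases eq_or_ne t [] with rfl | ht
    · simp [nextVal]
    · have := ih ht
      rw [nextVal] at this ⊢
      rw [List.foldr_cons, List.foldr_cons]
      omega

/-- What a scan state knows about the word `p` when the height `h` has just been visited. -/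
structure LiftState (F : ℕ → ℕ) (N : ℕ) (st : Bool) (h : ℕ) (p : List ℕ) : Prop
    extends ScanState F N st h p where
  strictMono_le : ∀ b c, b < c → c ≤ h → F b < F c
  top_mem : F h ∈ p
  top_eq : st = false → F h + 1 = N
  exists_pair : st = true → ∃ y, F h < y ∧ [y, F h].Sublist p

/-- With the flag set, `F h` already occurs in `p` after a larger entry, so repeating it completes a
`100`. No copy ends earlier because `p` is restricted, and the amount added turns `F h` into `N`. -/
theorem LiftState.isLift {F : ℕ → ℕ} {N h : ℕ} {p : List ℕ} (S : LiftState F N true h p)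
    (t : List ℕ) :
    IsLift (p ++ F h :: raised F h t) (p ++ N :: raised (Function.update F h N) h t) := by
  have hlt : F h < N := by rw [S.next]; exact lt_nextVal_of_mem S.top_mem
  have hne : p ≠ [] := List.ne_nil_of_mem S.top_mem
  have hg : (p ++ F h :: raised F h t).getD p.length 0 = F h := by
    rw [List.getD_append_right _ _ _ _ le_rfl]; simp
  refine ⟨p.length, ⟨copy100EndsAt_iff.2 (S.exists_pair rfl), fun k hk => ?_⟩, ?_⟩
  · by_contra hlt'
    exact S.restricted.not_copy100EndsAt (not_le.1 hlt') hk
  · rw [hg, List.take_left' rfl, List.drop_left' rfl, foldr_max_add_one hne, ← S.next,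
      List.append_assoc, List.takeWhile_cons_of_pos (by simp),
      List.dropWhile_cons_of_pos (by simp), List.map_cons, List.cons_append,
      lift_raised (fun b hb => S.strictMono_le b h hb le_rfl) hlt.le]
    congr 2
    omega

theorem LiftState.reuse {F : ℕ → ℕ} {N : ℕ} {st : Bool} {h : ℕ} {p : List ℕ}
    (S : LiftState F N st h p) {b : ℕ} (hb : b < h ∨ (b = h ∧ st = false)) :
    LiftState F N (decide (b < h)) b (p ++ [F b]) where
  toScanState := S.toScanState.reuse hb
  strictMono_le c d hcd hd := S.strictMono_le c d hcd (by omega)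
  top_mem := by simp
  top_eq hst := by
    simp only [decide_eq_false_iff_not] at hst
    obtain ⟨rfl, hst'⟩ := hb.resolve_left hst
    exact S.top_eq hst'
  exists_pair hst := by
    have hlt : b < h := by simpa using hst
    exact ⟨F h, S.strictMono_le b h hlt le_rfl, pair_sublist_concat_iff.2 (.inr ⟨rfl, S.top_mem⟩)⟩

theorem LiftState.new {F : ℕ → ℕ} {N : ℕ} {st : Bool} {h : ℕ} {p : List ℕ}
    (S : LiftState F N st h p) {b : ℕ} (hb : b = if st then h else h + 1) :
    LiftState (Function.update F b N) (N + 1) false b (p ++ [N]) where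
  toScanState := S.toScanState.new hb
  strictMono_le c d hcd hd := by
    refine (S.toScanState.new hb).strictMono c d hcd ?_
    rcases hd.lt_or_eq with h | h
    · exact .inl h
    · exact .inr ⟨h, rfl⟩
  top_mem := by simp
  top_eq _ := by simp
  exists_pair hst := by simp at hst

theorem LiftState.reflTransGen {F : ℕ → ℕ} {N : ℕ} {st : Bool} {h : ℕ} {p : List ℕ}
    (S : LiftState F N st h p) {w : List ℕ} (hw : HeightOK st h w) :
    Relation.ReflTransGen IsLift (p ++ raised F h w) (p ++ liftScan F N st h w) := by
  induction w generalizing F N st h p with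
  | nil => exact .refl
  | cons b t ih =>
    rcases heightOK_cons_iff.1 hw with ⟨hb, hw⟩ | ⟨hb, hw⟩
    · rw [liftScan, if_pos hb, raised, min_eq_right (by omega), Nat.sub_self, Nat.add_zero,
        List.append_cons, List.append_cons p (F b) (liftScan _ _ _ _ _)]
      exact ih (S.reuse hb) hw
    · have hneg : ¬ (b < h ∨ (b = h ∧ st = false)) := by
        cases st <;> simp at hb ⊢ <;> omega
      have key := ih (S.new hb) hw
      rw [liftScan, if_neg hneg]
      rw [List.append_assoc, List.singleton_append, List.append_assoc, List.singleton_append]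
        at key
      cases st with
      | true =>
        obtain rfl : b = h := hb
        rw [raised, min_self, Nat.sub_self, Nat.add_zero]
        exact .head (S.isLift t) key
      | false =>
        obtain rfl : b = h + 1 := hb
        -- An ascent with the flag unset needs no lift: the top value is the maximum so far, and the
        -- raised entry is already `N`.
        have h1 := S.top_eq rfl
        rw [raised, min_eq_left (by omega), Nat.add_sub_cancel_left, h1]
        have h2 : raised (Function.update F (h + 1) N) (h + 1) t = raised F h t := by
          rw [raised_succ (by rw [Function.update_self, Function.update_of_ne (by omega), h1])]
          exact raised_congr (fun c hc => Function.update_of_ne (by omega) _ _) t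
        rwa [h2] at key

theorem reflTransGen_liftScan {w : List ℕ} (hw : HeightOK true 0 w) :
    Relation.ReflTransGen IsLift w (liftScan (fun _ => 0) 0 true 0 w) := by
  cases w with
  | nil => exact .refl
  | cons b t =>
    rcases heightOK_cons_iff.1 hw with ⟨hb, -⟩ | ⟨hb, hw⟩
    · simp at hb
    · obtain rfl : b = 0 := hb
      -- The invariant needs `F h` to occur in the prefix, so it starts only after the forced first
      -- letter `0`.
      have S : LiftState (Function.update (fun _ => 0) 0 0) (0 + 1) false 0 ([] ++ [0]) :=
        { toScanState := (scanState_nil _).new rfl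
          strictMono_le := fun b c _ _ => by omega
          top_mem := by simp
          top_eq := by simp
          exists_pair := by simp }
      have := S.reflTransGen hw
      rw [raised_zero (by simp)] at this
      rw [liftScan, if_neg (by simp)]
      simpa using this

/-! ### Dyck paths and height words. -/

open DyckStep in
/-- The lattice paths from height `h` to height `0` that stay nonnegative. -/
def PathFrom : ℕ → List DyckStep → Prop
  | h, [] => h = 0
  | h, U :: s => PathFrom (h + 1) s
  | h, D :: s => 0 < h ∧ PathFrom (h - 1) s

open DyckStep in
theorem pathFrom_iff (h : ℕ) (l : List DyckStep) : PathFrom h l ↔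
    h + l.count U = l.count D ∧ ∀ i, (l.take i).count D ≤ h + (l.take i).count U := by
  induction l generalizing h with
  | nil => simp [PathFrom]
  | cons a s ih =>
    have hall : ∀ P : ℕ → Prop, (∀ i, P i) ↔ P 0 ∧ ∀ i, P (i + 1) := fun P =>
      ⟨fun H => ⟨H 0, fun i => H _⟩, fun H i => by cases i; exacts [H.1, H.2 _]⟩
    rw [hall]
    cases a with
    | U =>
      simp only [PathFrom, ih, List.take_zero, List.take_succ_cons, List.count_cons_self,
        List.count_cons_of_ne (show U ≠ D by decide), List.count_nil]
      refine and_congr (by omega) ⟨fun H => ⟨by omega, fun i => ?_⟩, fun H i => ?_⟩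
      · have := H i; omega
      · have := H.2 i; omega
    | D =>
      simp only [PathFrom, ih, List.take_zero, List.take_succ_cons, List.count_cons_self,
        List.count_cons_of_ne (show D ≠ U by decide), List.count_nil]
      constructor
      · rintro ⟨h0, h1, h2⟩
        refine ⟨by omega, by omega, fun i => ?_⟩
        have := h2 i; omega
      · rintro ⟨h1, -, h2⟩
        have h0 : 0 < h := by
          have := h2 0
          simp at this; omega
        refine ⟨h0, by omega, fun i => ?_⟩
        have := h2 i; omega

/-- The path from height `h` whose upsteps have the given starting heights. -/
def pathOfHeights : ℕ → List ℕ → List DyckStep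
  | h, [] => List.replicate h DyckStep.D
  | h, b :: t => List.replicate (h - b) DyckStep.D ++ DyckStep.U :: pathOfHeights (b + 1) t

/-- The words that are height words of paths starting at height `h`. -/
def IsHeightWord : ℕ → List ℕ → Prop
  | _, [] => True
  | h, b :: t => b ≤ h ∧ IsHeightWord (b + 1) t

theorem pathOfHeights_succ {h : ℕ} {w : List ℕ} (hw : IsHeightWord h w) :
    pathOfHeights (h + 1) w = DyckStep.D :: pathOfHeights h w := by
  cases w with
  | nil => rfl
  | cons b t =>
    rw [pathOfHeights, pathOfHeights, Nat.succ_sub hw.1, List.replicate_succ, List.cons_append]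

theorem IsHeightWord.mono {h k : ℕ} (hk : h ≤ k) {w : List ℕ} (hw : IsHeightWord h w) :
    IsHeightWord k w := by
  cases w with
  | nil => trivial
  | cons b t => exact ⟨hw.1.trans hk, hw.2⟩

theorem PathFrom.eq_pathOfHeights {h : ℕ} {l : List DyckStep} (hl : PathFrom h l) :
    IsHeightWord h (upHeightsFrom h l) ∧ pathOfHeights h (upHeightsFrom h l) = l := by
  induction l generalizing h with
  | nil =>
    obtain rfl : h = 0 := hl
    exact ⟨trivial, rfl⟩
  | cons a s ih =>
    cases a with
    | U =>
      have := ih (h := h + 1) hl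
      exact ⟨⟨le_rfl, this.1⟩, by simp [upHeightsFrom, pathOfHeights, this.2]⟩
    | D =>
      obtain ⟨k, rfl⟩ : ∃ k, h = k + 1 := ⟨h - 1, by have := hl.1; omega⟩
      have := ih hl.2
      rw [Nat.add_sub_cancel] at this
      rw [upHeightsFrom, Nat.add_sub_cancel, pathOfHeights_succ this.1, this.2]
      exact ⟨this.1.mono (Nat.le_succ k), rfl⟩

theorem pathFrom_replicate_append (m h : ℕ) (l : List DyckStep) :
    PathFrom (m + h) (List.replicate m DyckStep.D ++ l) ↔ PathFrom h l := by
  induction m with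
  | zero => simp
  | succ m ih =>
    rw [List.replicate_succ, List.cons_append, PathFrom, show m + 1 + h - 1 = m + h by omega, ih]
    exact and_iff_right (by omega)

theorem upHeightsFrom_replicate_append (m h : ℕ) (l : List DyckStep) :
    upHeightsFrom (m + h) (List.replicate m DyckStep.D ++ l) = upHeightsFrom h l := by
  induction m with
  | zero => simp
  | succ m ih =>
    rw [List.replicate_succ, List.cons_append, upHeightsFrom,
      show m + 1 + h - 1 = m + h by omega, ih]

theorem IsHeightWord.pathFrom {h : ℕ} {w : List ℕ} (hw : IsHeightWord h w) :
    PathFrom h (pathOfHeights h w) ∧ upHeightsFrom h (pathOfHeights h w) = w := by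
  induction w generalizing h with
  | nil =>
    have h1 := pathFrom_replicate_append h 0 []
    have h2 := upHeightsFrom_replicate_append h 0 []
    rw [List.append_nil, Nat.add_zero] at h1 h2
    exact ⟨h1.2 rfl, h2⟩
  | cons b t ih =>
    obtain ⟨h1, h2⟩ := ih hw.2
    have h3 := pathFrom_replicate_append (h - b) b (DyckStep.U :: pathOfHeights (b + 1) t)
    have h4 := upHeightsFrom_replicate_append (h - b) b (DyckStep.U :: pathOfHeights (b + 1) t)
    rw [Nat.sub_add_cancel hw.1] at h3 h4
    exact ⟨h3.2 h1, by rw [pathOfHeights, h4, upHeightsFrom, h2]⟩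

theorem length_upHeightsFrom (h : ℕ) (l : List DyckStep) :
    (upHeightsFrom h l).length = l.count DyckStep.U := by
  induction l generalizing h with
  | nil => rfl
  | cons a s ih => cases a <;> simp [upHeightsFrom, ih]

open DyckStep in
theorem DDUU_infix_replicate_append (m : ℕ) (l : List DyckStep) :
    [D, D, U, U].IsInfix (List.replicate m D ++ D :: D :: U :: l) ↔
      [D, D, U, U].IsInfix (D :: D :: U :: l) := by
  induction m with
  | zero => simp
  | succ m ih =>
    rw [List.replicate_succ, List.cons_append, List.infix_cons_iff, ih, or_iff_right]
    rcases m with _ | _ | m <;> simp [List.replicate_succ]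

open DyckStep in
/-- Avoiding `DDUU` means that no descent of the height word is followed by an ascent. -/
theorem heightOK_iff (st : Bool) (h : ℕ) (w : List ℕ) : HeightOK st h w ↔
    IsHeightWord (h + 1) w ∧
      ¬ [D, D, U, U].IsInfix ((if st then [D, D, U] else [U]) ++ pathOfHeights (h + 1) w) := by
  induction w generalizing st h with
  | nil =>
    refine iff_of_true trivial ⟨trivial, ?_⟩
    intro hi
    have h1 : ∀ m, ¬ [D, D, U, U].IsInfix (List.replicate m D) := fun m hi =>
      absurd (List.eq_of_mem_replicate (hi.subset (show U ∈ _ by simp))) (by decide)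
    have h2 := h1 h
    have h3 := h1 (h + 1)
    rw [List.replicate_succ] at h3
    cases st <;> simp [pathOfHeights, List.infix_cons_iff, List.replicate_succ] at hi h3 <;>
      tauto
  | cons b t ih =>
    rw [HeightOK, ih, IsHeightWord, pathOfHeights]
    rcases lt_trichotomy b h with hb | rfl | hb
    · obtain ⟨m, rfl⟩ : ∃ m, h = b + 1 + m := ⟨h - (b + 1), by omega⟩
      -- The path stands at `h + 1` after its upstep, so a descent in height means at least two `D`s
      -- before the next `U`. The last two are split off to form the new flag prefix.
      have e : List.replicate (b + 1 + m + 1 - b) D ++ U :: pathOfHeights (b + 1) t =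
          List.replicate m D ++ D :: D :: U :: pathOfHeights (b + 1) t := by
        rw [show b + 1 + m + 1 - b = m + 2 by omega, List.replicate_add, List.append_assoc]
        rfl
      have key := DDUU_infix_replicate_append m (pathOfHeights (b + 1) t)
      have k1 : b < b + 1 + m + if st = true then 1 else 2 := by split_ifs <;> omega
      have k2 : b ≤ b + 1 + m + 1 := by omega
      simp only [e, k1, k2, hb, decide_true, if_true, true_and]
      refine and_congr_right fun _ => not_congr ?_
      simp only [List.cons_append, List.nil_append]
      rw [← key]
      -- The old prefix is followed by a `D`, so no `DDUU` can start inside it.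
      have k3 : ∀ l', ¬ U :: l' <+: List.replicate m D ++ D :: D :: U :: pathOfHeights (b + 1) t :=
        fun l' => by cases m <;> simp [List.replicate_succ]
      cases st <;> simp [List.infix_cons_iff, k3]
    · have k1 : b < b + if st = true then 1 else 2 := by split_ifs <;> omega
      simp only [k1, lt_irrefl, decide_false, true_and, Nat.le_succ,
        Nat.add_sub_cancel_left]
      refine and_congr_right fun _ => not_congr ?_
      cases st <;> simp [List.infix_cons_iff]
    · have k0 : ¬ b < h := by omega
      simp only [k0, decide_false]
      cases st with
      | true =>
        rcases Nat.lt_or_ge (h + 1) b with hb' | hb'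
        · have k1 : ¬ b < h + 1 := by omega
          have k2 : ¬ b ≤ h + 1 := by omega
          simp [k1, k2]
        -- The prefix `DDU` followed by `U` is the forbidden factor, so both sides fail.
        · obtain rfl : b = h + 1 := by omega
          simp [List.infix_cons_iff]
      | false =>
        have k1 : b < h + 2 ↔ b ≤ h + 1 := by omega
        simp only [reduceCtorEq, if_false, k1, and_assoc]
        refine and_congr_right fun hle => and_congr_right fun _ => not_congr ?_
        obtain rfl : b = h + 1 := by omega
        simp [List.infix_cons_iff]

theorem DyckWord.pathFrom (d : DyckWord) : PathFrom 0 d.toList :=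
  (pathFrom_iff 0 _).2 ⟨by rw [zero_add, d.count_U_eq_count_D],
    fun i => by rw [zero_add]; exact d.count_D_le_count_U i⟩

/-- `heightOK_iff` describes what follows an upstep. At the start there is none, but the set flag at
height `0` forces the first entry to be `0`, and that lemma then applies to the tail. -/
theorem heightOK_zero_iff (w : List ℕ) : HeightOK true 0 w ↔ IsHeightWord 0 w ∧
    ¬ [DyckStep.D, DyckStep.D, DyckStep.U, DyckStep.U].IsInfix (pathOfHeights 0 w) := by
  cases w with
  | nil => exact iff_of_true trivial ⟨trivial, by simp [pathOfHeights]⟩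
  | cons b t =>
    rw [HeightOK, IsHeightWord, heightOK_iff]
    rcases Nat.eq_zero_or_pos b with rfl | hb
    · simp [pathOfHeights]
    · have h1 : ¬ b < 1 := by omega
      have h2 : ¬ b ≤ 0 := by omega
      simp [h2, hb.ne']

/-- Dyck words avoiding `DDUU` correspond to admissible height words. -/
theorem bijOn_upHeightWord (n : ℕ) :
    Set.BijOn upHeightWord (dyckAvoidDDUU n) {w | w.length = n ∧ HeightOK true 0 w} := by
  refine ⟨?_, ?_, ?_⟩
  · rintro d ⟨hd, hinf⟩
    obtain ⟨h1, h2⟩ := d.pathFrom.eq_pathOfHeights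
    refine ⟨(length_upHeightsFrom 0 _).trans hd, (heightOK_zero_iff _).2 ⟨h1, ?_⟩⟩
    rwa [upHeightWord, h2]
  · intro d _ d' _ e
    have h1 := d.pathFrom.eq_pathOfHeights.2
    have h2 := d'.pathFrom.eq_pathOfHeights.2
    rw [upHeightWord, upHeightWord] at e
    exact DyckWord.ext (by rw [← h1, ← h2, e])
  · rintro w ⟨hl, hw⟩
    obtain ⟨h1, h2⟩ := (heightOK_zero_iff w).1 hw
    obtain ⟨h3, h4⟩ := h1.pathFrom
    have h5 := (pathFrom_iff 0 _).1 h3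
    simp only [zero_add] at h5
    refine ⟨⟨pathOfHeights 0 w, h5.1, h5.2⟩, ⟨?_, h2⟩, h4⟩
    exact ((length_upHeightsFrom 0 _).symm.trans (congrArg List.length h4)).trans hl

/-! ### The bijection and the enumeration. -/

/-- Admissible height words correspond to ascent sequences avoiding `100` and `101`. -/
theorem bijOn_liftScan (n : ℕ) :
    Set.BijOn (liftScan (fun _ => 0) 0 true 0) {w | w.length = n ∧ HeightOK true 0 w}
      (ascentAvoiders {[1, 0, 0], [1, 0, 1]} n) := by
  have S := scanState_nil fun _ => 0
  refine ⟨?_, ?_, ?_⟩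
  · rintro w ⟨hl, hw⟩
    rw [mem_ascentAvoiders_iff, avoidingAscent_iff_restricted, length_liftScan]
    exact ⟨hl, (S.restricted_append_iff _).2 ⟨w, hw, rfl⟩⟩
  · rintro w ⟨-, hw⟩ w' ⟨-, hw'⟩ e
    exact S.liftScan_injOn hw hw' e
  · intro v hv
    rw [mem_ascentAvoiders_iff, avoidingAscent_iff_restricted] at hv
    obtain ⟨w, hw, rfl⟩ := (S.restricted_append_iff v).1 hv.2
    exact ⟨w, ⟨by rw [← hv.1, length_liftScan], hw⟩, rfl⟩

theorem ncard_ascentAvoiders (n : ℕ) :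
    (ascentAvoiders {[1, 0, 0], [1, 0, 1]} n).ncard = heightCount n true 0 := by
  have h : {w : List ℕ | w.length = n ∧ HeightOK true 0 w} = heightWords n true 0 := by
    ext w
    exact (mem_heightWords n true 0 w).symm
  rw [← (bijOn_liftScan n).image_eq, (bijOn_liftScan n).injOn.ncard_image, h,
    Set.ncard_coe_finset, card_heightWords]

theorem mainTheorem1 :
    (∃ S : PowerSeries ℚ,
      PowerSeries.constantCoeff S = 1 ∧
      S ^ 2 = 1 - 4 * PowerSeries.X + 2 * PowerSeries.X ^ 2 + PowerSeries.X ^ 4 ∧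
      2 * PowerSeries.X ^ 2 *
          PowerSeries.mk (fun n => ((ascentAvoiders {[1, 0, 0], [1, 0, 1]} n).ncard : ℚ)) =
        (1 - PowerSeries.X) ^ 2 - S) ∧
    (∀ n : ℕ, ∃ φ : dyckAvoidDDUU n → ascentAvoiders {[1, 0, 0], [1, 0, 1]} n,
      Function.Bijective φ ∧
      ∀ d : dyckAvoidDDUU n,
        Relation.ReflTransGen IsLift (upHeightWord (d : DyckWord)) (φ d : List ℕ)) := by
  refine ⟨?_, fun n => ?_⟩
  · obtain ⟨g, hg⟩ := exists_height_series
    have e : PowerSeries.mk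
        (fun n => ((ascentAvoiders {[1, 0, 0], [1, 0, 1]} n).ncard : ℚ)) = g := by
      ext n
      have := (coeff_height_series g hg n 0).1
      rw [pow_zero, mul_one] at this
      rw [PowerSeries.coeff_mk, ncard_ascentAvoiders, this]
    rw [e]
    -- The square root is read off from the closed form; its square is the discriminant of the
    -- quadratic equation for `g`.
    refine ⟨(1 - PowerSeries.X) ^ 2 - 2 * PowerSeries.X ^ 2 * g, by simp, ?_, by ring⟩
    linear_combination (-4 * PowerSeries.X ^ 2) * hg
  · have hB := (bijOn_liftScan n).comp (bijOn_upHeightWord n)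
    exact ⟨hB.mapsTo.restrict, hB.bijective,
      fun d => reflTransGen_liftScan ((bijOn_upHeightWord n).mapsTo d.2).2⟩
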